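/- Let $\Omega=\{\xi\in\mathbb{R}^3:|\xi|=1\}$ be the unit sphere, and let the Beltrami operator $\Delta^*$ be the tangential part of the Laplace operator, $\Delta_x=\frac{1}{r^2}\frac{\partial}{\partial r}r^2\frac{\partial}{\partial r}+\frac{1}{r^2}\Delta^*_\xi$ with $r=|x|$, $\xi=x/|x|$; that is, $\Delta^*U(\xi)$ is the Laplacian of $x\mapsto U(x/|x|)$ at the point $\xi\in\Omega$. For $\xi\in\Omega$ and $\rho\in(0,2)$ let $\Gamma_\rho(\xi)=\{\eta\in\Omega:1-\xi\cdot\eta<\rho\}$ be the spherical cap with center $\xi$ and radius $\rho$; closures $\overline{\Gamma_\rho(\xi)}$ and boundaries $\partial\Gamma_\rho(\xi)$ are taken in $\Omega$, and $d\sigma$ denotes the line element (integration with respect to length). **Theorem (Mean Value Property II).** Let $\Gamma\subset\Omega$ be open in $\Omega$ (for example, a subdomain with smooth boundary curve) and let $U:\Gamma\to\mathbb{R}$ be continuous. Then $U$ is harmonic in $\Gamma$ with respect to the Beltrami operator, i.e. $U$ is of class $\mathrm{C}^{(2)}(\Gamma)$ and $\Delta^*U=0$ in $\Gamma$, if and only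 if $$U(\xi)=\frac{1}{2\pi\sqrt{\rho(2-\rho)}}\int_{\partial\Gamma_\rho(\xi)}U(\eta)\,d\sigma(\eta)$$ for every $\xi\in\Gamma$ and every $\rho\in(0,2)$ such that $\overline{\Gamma_\rho(\xi)}\subset\Gamma$. -/

import Mathlib

open scoped Manifold ContDiff RealInnerProductSpace

noncomputable section

/-- The unit sphere `Ω` in `ℝ³`. -/
abbrev UnitSphere : Type := Metric.sphere (0 : EuclideanSpace ℝ (Fin 3)) 1

/-- The extension `x ↦ U (x / |x|)` of a function on the unit sphere to `ℝ³ \ {0}`, constant along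
rays (with the value `0` at the origin). -/
def radialExtension (U : UnitSphere → ℝ) (x : EuclideanSpace ℝ (Fin 3)) : ℝ :=
  if hx : x = 0 then 0
  else U ⟨‖x‖⁻¹ • x, by simp [norm_smul, inv_mul_cancel₀ (norm_ne_zero_iff.mpr hx)]⟩

/-- The Beltrami operator `Δ*`, the tangential part of the Laplace operator in
`Δ = r⁻² ∂ᵣ (r² ∂ᵣ) + r⁻² Δ*`. Applied to `x ↦ U (x / |x|)`, the radial part vanishes, so that
`Δ* U (ξ)` is the Laplacian of that function at `ξ`, where `r = 1`. -/
def beltrami (U : UnitSphere → ℝ) (ξ : UnitSphere) : ℝ :=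
  Laplacian.laplacian (radialExtension U) (ξ : EuclideanSpace ℝ (Fin 3))

/-- `U` is harmonic in `Γ` with respect to the Beltrami operator: it is of class `C²` on `Γ`
and `Δ* U = 0` in `Γ`. -/
def BeltramiHarmonicOn (U : UnitSphere → ℝ) (Γ : Set UnitSphere) : Prop :=
  ContMDiffOn (𝓡 2) 𝓘(ℝ, ℝ) 2 U Γ ∧ ∀ ξ ∈ Γ, beltrami U ξ = 0

/-- The spherical cap `Γ_ρ(ξ)` with center `ξ` and radius `ρ`. -/
def sphericalCap (ξ : UnitSphere) (ρ : ℝ) : Set UnitSphere :=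
  {η | 1 - ⟪(ξ : EuclideanSpace ℝ (Fin 3)), (η : EuclideanSpace ℝ (Fin 3))⟫ < ρ}

/-- The integral `∫ F dσ` over a curve `C` on the unit sphere with respect to the line element,
that is, with respect to length (one-dimensional Hausdorff measure) on `C`. -/
def arcLengthIntegral (C : Set UnitSphere) (F : UnitSphere → ℝ) : ℝ :=
  ∫ η in C, F η ∂(MeasureTheory.Measure.hausdorffMeasure 1 : MeasureTheory.Measure UnitSphere)

end

noncomputable section

open Real Set Filter Topology MeasureTheory

/-- The ambient Euclidean space `ℝ³`. -/
local notation "E3" => EuclideanSpace ℝ (Fin 3)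

/-! The normalized arc length mean over a cap boundary is the average over the azimuth `φ` at polar
angle `θ`, with `ρ = 1 - cos θ`: the circle has Euclidean radius `sin θ` and `ρ(2 - ρ) = sin² θ`.
This turns the claim into one about azimuthal means (`meanValue_iff`).

Let `V` be the radial extension, homogeneous of degree 0, and `M(θ)` its azimuthal integral.
Integrating the spherical Laplacian over the azimuth removes the azimuthal part by periodicity,
which leaves `(sin θ · M'(θ))' = sin θ · ∫ ΔV dφ` (`hasDerivAt_azimuthalFlux`). If `ΔV = 0`, then
`sin θ · M'` is constant and vanishes at the pole, so `M` is constant and equals `2π` times the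
value at the center. Conversely, for `V` of class C², constant `M` forces `∫ ΔV dφ = 0` on all small
circles, and `θ → 0` gives `ΔV = 0` at the center.

For the converse, a merely continuous `U` must first be shown to be C². Rotating `y` about the axis
through `x` moves its direction along a circle centered at the direction of `x`, so the mean value
property says that rotational means of `V` reproduce `V x`. A radial mollifier centered at `x` is
invariant under these rotations, so near each point of `Γ` the function `V` is a constant multiple
of its own mollification, hence C² (`HasAzimuthalMeanValue.contDiffAt`). -/

/-- The point with polar angle `θ` and azimuth `φ` in spherical coordinates with axis `b 0`. -/
def polarPoint (b : OrthonormalBasis (Fin 3) ℝ E3) (θ φ : ℝ) : E3 :=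
  cos θ • b 0 + sin θ • (cos φ • b 1 + sin φ • b 2)

/-- The derivative of `polarPoint` with respect to the polar angle. -/
def polarTangent (b : OrthonormalBasis (Fin 3) ℝ E3) (θ φ : ℝ) : E3 :=
  -sin θ • b 0 + cos θ • (cos φ • b 1 + sin φ • b 2)

/-- The unit vector in the direction of increasing azimuth. -/
def azimuthTangent (b : OrthonormalBasis (Fin 3) ℝ E3) (φ : ℝ) : E3 :=
  -sin φ • b 1 + cos φ • b 2

/-! ### Spherical coordinates about an arbitrary axis. -/

section PolarCoordinates

variable (b : OrthonormalBasis (Fin 3) ℝ E3)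

theorem inner_basis_combination (x y z x' y' z' : ℝ) :
    ⟪x • b 0 + y • b 1 + z • b 2, x' • b 0 + y' • b 1 + z' • b 2⟫ = x * x' + y * y' + z * z' := by
  have h := b.inner_eq_ite
  simp only [inner_add_left, inner_add_right, inner_smul_left, inner_smul_right, h]
  simp
  ring

theorem polarPoint_eq (θ φ : ℝ) : polarPoint b θ φ =
    cos θ • b 0 + (sin θ * cos φ) • b 1 + (sin θ * sin φ) • b 2 := by
  unfold polarPoint; module

theorem polarTangent_eq (θ φ : ℝ) : polarTangent b θ φ =
    (-sin θ) • b 0 + (cos θ * cos φ) • b 1 + (cos θ * sin φ) • b 2 := by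
  unfold polarTangent; module

theorem azimuthTangent_eq (φ : ℝ) : azimuthTangent b φ =
    (0 : ℝ) • b 0 + (-sin φ) • b 1 + (cos φ) • b 2 := by
  unfold azimuthTangent; module

theorem orthonormal_polarFrame (θ φ : ℝ) :
    Orthonormal ℝ ![polarPoint b θ φ, polarTangent b θ φ, azimuthTangent b φ] := by
  rw [orthonormal_iff_ite]
  have h1 := sin_sq_add_cos_sq θ
  have h2 := sin_sq_add_cos_sq φ
  intro i j
  fin_cases i <;> fin_cases j <;>
    simp only [polarPoint_eq, polarTangent_eq, azimuthTangent_eq, Matrix.cons_val_zero,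
      Matrix.cons_val_one, Matrix.cons_val, Fin.zero_eta, Fin.mk_one, Fin.reduceFinMk,
      inner_basis_combination, Fin.reduceEq, if_true, if_false] <;>
    first
    | ring1
    | linear_combination h2
    | linear_combination h1 + sin θ ^ 2 * h2
    | linear_combination h1 + cos θ ^ 2 * h2
    | linear_combination sin θ * cos θ * h2

/-- The orthonormal frame of spherical coordinates at the point with angles `θ`, `φ`. -/
def polarFrame (θ φ : ℝ) : OrthonormalBasis (Fin 3) ℝ E3 :=
  OrthonormalBasis.mk (orthonormal_polarFrame b θ φ) (by
    rw [(orthonormal_polarFrame b θ φ).linearIndependent.span_eq_top_of_card_eq_finrank' (by simp)])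

theorem polarFrame_zero (θ φ : ℝ) : polarFrame b θ φ 0 = polarPoint b θ φ := by
  simp [polarFrame]

theorem polarFrame_one (θ φ : ℝ) : polarFrame b θ φ 1 = polarTangent b θ φ := by
  simp [polarFrame]

theorem polarFrame_two (θ φ : ℝ) : polarFrame b θ φ 2 = azimuthTangent b φ := by
  simp [polarFrame]

theorem norm_polarPoint (θ φ : ℝ) : ‖polarPoint b θ φ‖ = 1 := by
  rw [← polarFrame_zero]; exact (polarFrame b θ φ).norm_eq_one 0

theorem inner_polarPoint (θ φ θ' φ' : ℝ) : ⟪polarPoint b θ φ, polarPoint b θ' φ'⟫ =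
    cos θ * cos θ' + sin θ * sin θ' * cos (φ - φ') := by
  rw [polarPoint_eq, polarPoint_eq, inner_basis_combination, cos_sub]; ring

theorem inner_axis_polarPoint (θ φ : ℝ) : ⟪b 0, polarPoint b θ φ⟫ = cos θ := by
  simpa [polarPoint] using inner_polarPoint b 0 0 θ φ

/-- Both angles are arguments of complex numbers: the azimuth of `w`, built from the two horizontal
components, and the polar angle of `v`, built from the axial component and `‖w‖`. Since `v` has
nonnegative imaginary part, its argument lies in `[0, π]`. -/
theorem exists_eq_norm_smul_polarPoint (y : E3) :
    ∃ θ ∈ Icc 0 π, ∃ α, y = ‖y‖ • polarPoint b θ α := by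
  set w : ℂ := ⟨⟪b 1, y⟫, ⟪b 2, y⟫⟩ with hw
  set v : ℂ := ⟨⟪b 0, y⟫, ‖w‖⟩ with hv
  have hv' : ‖v‖ = ‖y‖ := by
    have h1 : ‖v‖ ^ 2 = ‖y‖ ^ 2 := by
      rw [← b.sum_sq_norm_inner_right y, Fin.sum_univ_three, Complex.sq_norm,
        Complex.normSq_apply]
      have : ‖w‖ * ‖w‖ = ⟪b 1, y⟫ * ⟪b 1, y⟫ + ⟪b 2, y⟫ * ⟪b 2, y⟫ := by
        rw [← sq, Complex.sq_norm, Complex.normSq_apply]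
      simp only [Real.norm_eq_abs, sq_abs, hv, this]
      ring
    exact (pow_left_inj₀ (norm_nonneg _) (norm_nonneg _) two_ne_zero).1 h1
  refine ⟨v.arg, ⟨Complex.arg_nonneg_iff.2 (norm_nonneg _), Complex.arg_le_pi v⟩, w.arg, ?_⟩
  have h0 : ‖y‖ * cos v.arg = ⟪b 0, y⟫ := by rw [← hv', Complex.norm_mul_cos_arg]
  have h1 : ‖y‖ * sin v.arg = ‖w‖ := by rw [← hv', Complex.norm_mul_sin_arg]
  have h2 : ‖w‖ * cos w.arg = ⟪b 1, y⟫ := by rw [Complex.norm_mul_cos_arg]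
  have h3 : ‖w‖ * sin w.arg = ⟪b 2, y⟫ := by rw [Complex.norm_mul_sin_arg]
  conv_lhs => rw [← b.sum_repr' y, Fin.sum_univ_three, ← h0, ← h2, ← h3, ← h1]
  unfold polarPoint
  module

theorem exists_eq_polarPoint_of_inner {y : E3} (hy : ‖y‖ = 1) {θ : ℝ} (hθ : θ ∈ Icc 0 π)
    (h : ⟪b 0, y⟫ = cos θ) : ∃ α, y = polarPoint b θ α := by
  obtain ⟨θ', hθ', α, e⟩ := exists_eq_norm_smul_polarPoint b y
  rw [hy, one_smul] at e
  refine ⟨α, ?_⟩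
  rw [e, inner_axis_polarPoint] at h
  rw [e, injOn_cos hθ' hθ h]

/-- `polarPoint` as a point of the unit sphere. -/
def spherePoint (θ φ : ℝ) : UnitSphere :=
  ⟨polarPoint b θ φ, by simp [norm_polarPoint]⟩

@[simp] theorem coe_spherePoint (θ φ : ℝ) : (spherePoint b θ φ : E3) = polarPoint b θ φ := rfl

theorem continuous_polarPoint : Continuous (fun p : ℝ × ℝ => polarPoint b p.1 p.2) := by
  unfold polarPoint; fun_prop

theorem continuous_spherePoint : Continuous (fun p : ℝ × ℝ => spherePoint b p.1 p.2) :=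
  (continuous_polarPoint b).subtype_mk _

theorem periodic_spherePoint (θ : ℝ) : Function.Periodic (spherePoint b θ) (2 * π) := by
  intro φ
  ext1
  simp [polarPoint]

/-- The metric of the sphere is the chordal one, so this chord law is what determines the Hausdorff
measure of a circle of latitude. -/
theorem dist_spherePoint (θ φ φ' : ℝ) (hθ : 0 ≤ sin θ) :
    dist (spherePoint b θ φ) (spherePoint b θ φ') = 2 * sin θ * |sin ((φ - φ') / 2)| := by
  rw [Subtype.dist_eq, dist_eq_norm]
  refine (pow_left_inj₀ (norm_nonneg _) (by positivity) two_ne_zero).1 ?_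
  rw [coe_spherePoint, coe_spherePoint, norm_sub_sq_real, inner_polarPoint, norm_polarPoint,
    norm_polarPoint, mul_pow, sq_abs]
  have h : cos (φ - φ') = 1 - 2 * sin ((φ - φ') / 2) ^ 2 := by
    rw [← cos_two_mul_eq_one_sub]; ring_nf
  rw [h]
  linear_combination (-2) * sin_sq_add_cos_sq θ

end PolarCoordinates

theorem exists_orthonormalBasis_zero_eq (ξ : UnitSphere) :
    ∃ b : OrthonormalBasis (Fin 3) ℝ E3, b 0 = ξ := by
  have hn : ‖(ξ : E3)‖ = 1 := by simp
  obtain ⟨b, hb⟩ := Orthonormal.exists_orthonormalBasis_extension_of_card_eq (𝕜 := ℝ)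
    (ι := Fin 3) (E := E3) (by simp) (v := fun _ => (ξ : E3)) (s := {0})
    (by
      rw [orthonormal_iff_ite]
      rintro ⟨i, hi⟩ ⟨j, hj⟩
      obtain rfl : i = 0 := hi
      obtain rfl : j = 0 := hj
      simp [hn])
  exact ⟨b, hb 0 rfl⟩

/-! ### One-dimensional Hausdorff measure on a curve obeying the chord law of a circle of radius
`s`. -/

theorem one_sub_mul_le_sin {δ x : ℝ} (hδ : δ ≤ 1) (hx : 0 ≤ x) (hxδ : x ≤ δ) :
    (1 - δ) * x ≤ sin x := by
  rcases hx.eq_or_lt with rfl | hx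
  · simp
  have := sin_gt_sub_cube hx
  nlinarith [mul_nonneg hx.le (sub_nonneg.2 hxδ), mul_pos hx hx, pow_pos hx 3]

section Circle

variable {X : Type*} [MetricSpace X] {γ : ℝ → X} {s : ℝ}

theorem lipschitzWith_of_chord (hs : 0 < s)
    (hγ : ∀ a b, dist (γ a) (γ b) = 2 * s * |sin ((a - b) / 2)|) :
    LipschitzWith s.toNNReal γ := by
  refine LipschitzWith.of_dist_le_mul fun a b => ?_
  rw [hγ, Real.coe_toNNReal _ hs.le, Real.dist_eq]
  have : |sin ((a - b) / 2)| ≤ |(a - b) / 2| := abs_sin_le_abs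
  rw [abs_div, abs_two] at this
  nlinarith

theorem injOn_of_chord (hs : 0 < s)
    (hγ : ∀ a b, dist (γ a) (γ b) = 2 * s * |sin ((a - b) / 2)|) :
    InjOn γ (Ioc 0 (2 * π)) := by
  intro x hx y hy h
  have h0 : sin ((x - y) / 2) = 0 := by
    have := hγ x y
    rw [h, dist_self] at this
    simpa [hs.ne'] using this.symm
  have := (sin_eq_zero_iff_of_lt_of_lt (by linarith [hx.1, hy.2]) (by linarith [hx.2, hy.1])).1 h0
  linarith

theorem le_dist_of_chord (hs : 0 < s)
    (hγ : ∀ a b, dist (γ a) (γ b) = 2 * s * |sin ((a - b) / 2)|) {δ : ℝ} (hδ : δ ≤ 1) {a b : ℝ}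
    (hab : |a - b| ≤ δ) : s * (1 - δ) * |a - b| ≤ dist (γ a) (γ b) := by
  have h0 := abs_nonneg (a - b)
  have h1 := one_sub_mul_le_sin hδ (x := |a - b| / 2) (by positivity) (by linarith)
  have h2 : |sin ((a - b) / 2)| = |sin (|a - b| / 2)| := by
    rcases abs_cases (a - b) with ⟨h, -⟩ | ⟨h, -⟩ <;> rw [h]
    rw [neg_div, sin_neg, abs_neg]
  rw [hγ, h2]
  have h3 := le_abs_self (sin (|a - b| / 2))
  nlinarith

variable [MeasurableSpace X] [BorelSpace X]

/-- Cut `A` into pieces of diameter at most `δ`. On each piece chords are at least `s (1 - δ)` times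
the parameter distance, so the inverse of `γ` is Lipschitz there and cannot increase measure too
much. Injectivity keeps the images disjoint, and the bounds add up. -/
theorem mul_volume_le_hausdorffMeasure_image (hs : 0 < s)
    (hγ : ∀ a b, dist (γ a) (γ b) = 2 * s * |sin ((a - b) / 2)|) {A : Set ℝ}
    (hA : MeasurableSet A) (hA' : A ⊆ Ioc 0 (2 * π)) {δ : ℝ} (hδ0 : 0 < δ) (hδ : δ < 1) :
    ENNReal.ofReal (s * (1 - δ)) * volume A ≤ μH[1] (γ '' A) := by
  have hinj := (injOn_of_chord hs hγ).mono hA'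
  have hcont := (lipschitzWith_of_chord hs hγ).continuous
  have hc : 0 < s * (1 - δ) := by nlinarith
  set S : ℤ → Set ℝ := fun k => A ∩ Ioc (k • δ) ((k + 1) • δ) with hS
  have hSA : ∀ k, S k ⊆ A := fun k => inter_subset_left
  have hSm : ∀ k, MeasurableSet (S k) := fun k => hA.inter measurableSet_Ioc
  have hSU : ⋃ k, S k = A := by
    rw [← inter_iUnion, iUnion_Ioc_zsmul hδ0, inter_univ]
  have hSd : Pairwise (Function.onFun Disjoint S) := fun i j hij =>
    (pairwise_disjoint_Ioc_zsmul δ hij).mono inter_subset_right inter_subset_right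
  have key : ∀ k, ENNReal.ofReal (s * (1 - δ)) * volume (S k) ≤ μH[1] (γ '' S k) := by
    intro k
    have hl : LipschitzOnWith (s * (1 - δ))⁻¹.toNNReal (Function.invFunOn γ A) (γ '' S k) := by
      refine LipschitzOnWith.of_dist_le_mul ?_
      rintro _ ⟨x, hx, rfl⟩ _ ⟨y, hy, rfl⟩
      rw [hinj.leftInvOn_invFunOn (hSA k hx), hinj.leftInvOn_invFunOn (hSA k hy),
        Real.coe_toNNReal _ (inv_nonneg.2 hc.le), Real.dist_eq, inv_mul_eq_div, le_div_iff₀' hc]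
      refine le_dist_of_chord hs hγ hδ.le ?_
      have h1 := hx.2
      have h2 := hy.2
      simp only [zsmul_eq_mul, Int.cast_add, Int.cast_one, mem_Ioc] at h1 h2
      rw [abs_le]
      constructor <;> linarith
    have h := hl.hausdorffMeasure_image_le zero_le_one
    have him : Function.invFunOn γ A '' (γ '' S k) = S k := by
      rw [image_image]
      refine (image_congr fun x hx => hinj.leftInvOn_invFunOn (hSA k hx)).trans (image_id _)
    rw [him, hausdorffMeasure_real, ENNReal.rpow_one] at h
    calc ENNReal.ofReal (s * (1 - δ)) * volume (S k)
        ≤ ENNReal.ofReal (s * (1 - δ)) * (ENNReal.ofReal (s * (1 - δ))⁻¹ * μH[1] (γ '' S k)) := by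
          gcongr; exact h
      _ = μH[1] (γ '' S k) := by
          rw [← mul_assoc, ← ENNReal.ofReal_mul hc.le, mul_inv_cancel₀ hc.ne', ENNReal.ofReal_one,
            one_mul]
  calc ENNReal.ofReal (s * (1 - δ)) * volume A
      = ∑' k, ENNReal.ofReal (s * (1 - δ)) * volume (S k) := by
        rw [ENNReal.tsum_mul_left, ← measure_iUnion hSd hSm, hSU]
    _ ≤ ∑' k, μH[1] (γ '' S k) := ENNReal.tsum_le_tsum key
    _ = μH[1] (γ '' A) := by
        rw [← measure_iUnion, ← image_iUnion, hSU]
        · intro i j hij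
          refine disjoint_left.2 ?_
          rintro _ ⟨x, hx, rfl⟩ ⟨y, hy, e⟩
          obtain rfl := hinj (hSA j hy) (hSA i hx) e
          exact disjoint_left.1 (hSd hij) hx hy
        · exact fun k => (hSm k).image_of_continuousOn_injOn hcont.continuousOn
            (hinj.mono (hSA k))

/-- The upper bound is the Lipschitz constant `s` of `γ`; the lower bound is the piecewise estimate
as `δ → 0`. -/
theorem hausdorffMeasure_image_of_chord (hs : 0 < s)
    (hγ : ∀ a b, dist (γ a) (γ b) = 2 * s * |sin ((a - b) / 2)|) {A : Set ℝ}
    (hA : MeasurableSet A) (hA' : A ⊆ Ioc 0 (2 * π)) :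
    μH[1] (γ '' A) = ENNReal.ofReal s * volume A := by
  apply le_antisymm
  · have := (lipschitzWith_of_chord hs hγ).hausdorffMeasure_image_le zero_le_one A
    rwa [hausdorffMeasure_real, ENNReal.rpow_one] at this
  · have hlim : Tendsto (fun δ : ℝ => ENNReal.ofReal (s * (1 - δ)) * volume A) (𝓝[>] 0)
        (𝓝 (ENNReal.ofReal s * volume A)) := by
      refine ENNReal.Tendsto.mul_const ?_ (Or.inl (by simpa using hs))
      have : Continuous fun δ : ℝ => ENNReal.ofReal (s * (1 - δ)) :=
        ENNReal.continuous_ofReal.comp (by fun_prop)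
      simpa using (this.tendsto 0).mono_left nhdsWithin_le_nhds
    refine le_of_tendsto hlim ?_
    filter_upwards [Ioo_mem_nhdsGT (zero_lt_one' ℝ)] with δ hδ
    exact mul_volume_le_hausdorffMeasure_image hs hγ hA hA' hδ.1 hδ.2

theorem setIntegral_hausdorffMeasure_of_chord (hs : 0 < s)
    (hγ : ∀ a b, dist (γ a) (γ b) = 2 * s * |sin ((a - b) / 2)|) (F : X → ℝ) :
    ∫ x in γ '' Ioc 0 (2 * π), F x ∂μH[1] = s * ∫ t in 0..2 * π, F (γ t) := by
  have hcont := (lipschitzWith_of_chord hs hγ).continuous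
  have hinj := injOn_of_chord hs hγ
  have hme : MeasurableEmbedding ((Ioc 0 (2 * π)).domRestrict γ) :=
    hcont.continuousOn.measurableEmbedding measurableSet_Ioc hinj
  have hmap : (μH[1] : Measure X).restrict (γ '' Ioc 0 (2 * π)) = ENNReal.ofReal s •
      Measure.map ((Ioc 0 (2 * π)).domRestrict γ) (Measure.comap Subtype.val volume) := by
    ext B hB
    have hpre : MeasurableSet (Ioc 0 (2 * π) ∩ γ ⁻¹' B) :=
      measurableSet_Ioc.inter (hcont.measurable hB)
    rw [Measure.restrict_apply hB, Measure.smul_apply, hme.map_apply, smul_eq_mul,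
      comap_subtype_coe_apply measurableSet_Ioc, inter_comm, ← image_inter_preimage,
      hausdorffMeasure_image_of_chord hs hγ hpre inter_subset_left]
    congr 2
    ext t
    simp [Set.domRestrict, and_comm]
  rw [hmap, integral_smul_measure, hme.integral_map, intervalIntegral.integral_of_le (by positivity),
    ← integral_subtype_comap measurableSet_Ioc, ENNReal.toReal_ofReal hs.le]
  rfl

end Circle

/-! ### Caps, their closures and boundaries, and the azimuthal form of the mean value property. -/

theorem isOpen_sphericalCap (ξ : UnitSphere) (ρ : ℝ) : IsOpen (sphericalCap ξ ρ) :=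
  isOpen_lt (by fun_prop) continuous_const

/-- A boundary point is the limit of the points on its meridian with smaller polar angle. -/
theorem polar_subset_closure_sphericalCap (b : OrthonormalBasis (Fin 3) ℝ E3) {ξ : UnitSphere}
    (hb : b 0 = ξ) {θ : ℝ} (hθ : θ ∈ Ioo 0 π) (α : ℝ) :
    spherePoint b θ α ∈ closure (sphericalCap ξ (1 - cos θ)) := by
  have hc : Continuous fun t => spherePoint b t α :=
    Continuous.subtype_mk (by unfold polarPoint; fun_prop) _
  have hlim : Tendsto (fun t => spherePoint b t α) (𝓝[<] θ) (𝓝 (spherePoint b θ α)) :=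
    (hc.tendsto θ).mono_left nhdsWithin_le_nhds
  refine mem_closure_of_tendsto hlim ?_
  filter_upwards [Ioo_mem_nhdsLT hθ.1] with t ht
  have : cos θ < cos t := cos_lt_cos_of_nonneg_of_le_pi ht.1.le hθ.2.le ht.2
  simp only [sphericalCap, mem_ofPred_eq, coe_spherePoint, ← hb, inner_axis_polarPoint]
  linarith

theorem frontier_sphericalCap (b : OrthonormalBasis (Fin 3) ℝ E3) {ξ : UnitSphere}
    (hb : b 0 = ξ) {θ : ℝ} (hθ : θ ∈ Ioo 0 π) :
    frontier (sphericalCap ξ (1 - cos θ)) = spherePoint b θ '' Ioc 0 (2 * π) := by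
  rw [(isOpen_sphericalCap ξ _).frontier_eq]
  apply Subset.antisymm
  · rintro η ⟨h1, h2⟩
    have h3 : closure (sphericalCap ξ (1 - cos θ)) ⊆
        {η : UnitSphere | 1 - ⟪(ξ : E3), (η : E3)⟫ ≤ 1 - cos θ} :=
      closure_minimal (fun η h => le_of_lt (mem_ofPred.1 h)) (isClosed_le (by fun_prop) continuous_const)
    have h4 : ⟪b 0, (η : E3)⟫ = cos θ := by
      have h5 := h3 h1
      simp only [sphericalCap, mem_ofPred_eq, not_lt] at h2 h5
      rw [hb]
      linarith
    obtain ⟨α, hα⟩ := exists_eq_polarPoint_of_inner b (by simp) (Ioo_subset_Icc_self hθ) h4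
    obtain ⟨t, ht, e⟩ := (periodic_spherePoint b θ).exists_mem_Ioc (by positivity) α 0
    exact ⟨t, by simpa using ht, by rw [← e]; exact Subtype.ext hα.symm⟩
  · rintro _ ⟨α, -, rfl⟩
    refine ⟨polar_subset_closure_sphericalCap b hb hθ α, ?_⟩
    simp [sphericalCap, ← hb, inner_axis_polarPoint]

theorem closure_sphericalCap (b : OrthonormalBasis (Fin 3) ℝ E3) {ξ : UnitSphere}
    (hb : b 0 = ξ) {θ : ℝ} (hθ : θ ∈ Ioo 0 π) :
    closure (sphericalCap ξ (1 - cos θ)) = {η : UnitSphere | cos θ ≤ ⟪(ξ : E3), (η : E3)⟫} := by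
  apply Subset.antisymm
  · exact closure_minimal (fun η h => by simp only [sphericalCap, mem_ofPred_eq] at h ⊢; linarith)
      (isClosed_le continuous_const (by fun_prop))
  · intro η hη
    rcases (mem_ofPred.1 hη).eq_or_lt with h | h
    · rw [← hb] at h
      obtain ⟨α, hα⟩ := exists_eq_polarPoint_of_inner b (by simp)
        (Ioo_subset_Icc_self hθ) h.symm
      have := polar_subset_closure_sphericalCap b hb hθ α
      convert this
      exact Subtype.ext hα
    · exact subset_closure (by simp only [sphericalCap, mem_ofPred_eq]; linarith)

/-- The normalized arc length mean over the boundary of a spherical cap is the mean over the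
azimuth. -/
theorem arcLengthIntegral_frontier_sphericalCap (b : OrthonormalBasis (Fin 3) ℝ E3)
    {ξ : UnitSphere} (hb : b 0 = ξ) {θ : ℝ} (hθ : θ ∈ Ioo 0 π) (U : UnitSphere → ℝ) :
    1 / (2 * π * √((1 - cos θ) * (2 - (1 - cos θ)))) *
      arcLengthIntegral (frontier (sphericalCap ξ (1 - cos θ))) U =
      (2 * π)⁻¹ * ∫ φ in 0..2 * π, U (spherePoint b θ φ) := by
  have hs : 0 < sin θ := sin_pos_of_mem_Ioo hθ
  have h1 : (1 - cos θ) * (2 - (1 - cos θ)) = sin θ ^ 2 := by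
    linear_combination - sin_sq_add_cos_sq θ
  rw [arcLengthIntegral, frontier_sphericalCap b hb hθ, h1, sqrt_sq hs.le,
    setIntegral_hausdorffMeasure_of_chord hs fun a c => dist_spherePoint b θ a c hs.le]
  field_simp

theorem meanValue_iff (Γ : Set UnitSphere) (U : UnitSphere → ℝ) :
    (∀ ξ ∈ Γ, ∀ ρ : ℝ, 0 < ρ → ρ < 2 → closure (sphericalCap ξ ρ) ⊆ Γ →
        U ξ = 1 / (2 * π * √(ρ * (2 - ρ))) *
          arcLengthIntegral (frontier (sphericalCap ξ ρ)) U) ↔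
    ∀ ξ ∈ Γ, ∀ b : OrthonormalBasis (Fin 3) ℝ E3, b 0 = ξ → ∀ θ ∈ Ioo 0 π,
      (∀ η : UnitSphere, cos θ ≤ ⟪(ξ : E3), (η : E3)⟫ → η ∈ Γ) →
      ∫ φ in 0..2 * π, U (spherePoint b θ φ) = 2 * π * U ξ := by
  constructor
  · intro h ξ hξ b hb θ hθ hcap
    have h1 : cos θ < 1 := by simpa using cos_lt_cos_of_nonneg_of_le_pi le_rfl hθ.2.le hθ.1
    have h2 : -1 < cos θ := by simpa using cos_lt_cos_of_nonneg_of_le_pi hθ.1.le le_rfl hθ.2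
    have := h ξ hξ (1 - cos θ) (by linarith) (by linarith)
      (by rw [closure_sphericalCap b hb hθ]; exact hcap)
    rw [arcLengthIntegral_frontier_sphericalCap b hb hθ] at this
    rw [this, mul_inv_cancel_left₀ (by positivity)]
  · intro h ξ hξ ρ h0 h2 hcap
    obtain ⟨b, hb⟩ := exists_orthonormalBasis_zero_eq ξ
    obtain ⟨θ, hθ, rfl⟩ : ∃ θ ∈ Ioo 0 π, ρ = 1 - cos θ := by
      refine ⟨arccos (1 - ρ), ⟨arccos_pos.2 (by linarith), ?_⟩, ?_⟩
      · exact (arccos_le_pi _).lt_of_ne fun e => by rw [arccos_eq_pi] at e; linarith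
      · rw [cos_arccos (by linarith) (by linarith)]; ring
    rw [arcLengthIntegral_frontier_sphericalCap b hb hθ, h ξ hξ b hb θ hθ,
      inv_mul_cancel_left₀ (by positivity)]
    rw [closure_sphericalCap b hb hθ] at hcap
    exact hcap

/-! ### Radial projection and transfer of regularity between the sphere and space. -/

/-- The radial projection `x ↦ x / |x|` onto the unit sphere (with an arbitrary value at `0`). -/
def toUnitSphere (x : E3) : UnitSphere :=
  if hx : x = 0 then ⟨EuclideanSpace.single 0 1, by simp⟩
  else ⟨‖x‖⁻¹ • x, by simp [norm_smul, inv_mul_cancel₀ (norm_ne_zero_iff.mpr hx)]⟩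

theorem coe_toUnitSphere {x : E3} (hx : x ≠ 0) : (toUnitSphere x : E3) = ‖x‖⁻¹ • x := by
  simp [toUnitSphere, hx]

theorem radialExtension_eq (U : UnitSphere → ℝ) {x : E3} (hx : x ≠ 0) :
    radialExtension U x = U (toUnitSphere x) := by
  simp [toUnitSphere, radialExtension, hx]

theorem toUnitSphere_smul {c : ℝ} (hc : 0 < c) (x : E3) :
    toUnitSphere (c • x) = toUnitSphere x := by
  by_cases hx : x = 0
  · simp [hx]
  · ext1
    rw [coe_toUnitSphere hx, coe_toUnitSphere (smul_ne_zero hc.ne' hx), norm_smul, smul_smul,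
      Real.norm_of_nonneg hc.le, mul_inv_rev, inv_mul_cancel_right₀ hc.ne']

theorem unitSphere_ne_zero (ξ : UnitSphere) : (ξ : E3) ≠ 0 := ne_zero_of_mem_unit_sphere ξ

@[simp] theorem toUnitSphere_coe (ξ : UnitSphere) : toUnitSphere (ξ : E3) = ξ := by
  ext1
  rw [coe_toUnitSphere (unitSphere_ne_zero ξ)]
  simp

theorem radialExtension_coe (U : UnitSphere → ℝ) (ξ : UnitSphere) : radialExtension U ξ = U ξ := by
  rw [radialExtension_eq U (unitSphere_ne_zero ξ), toUnitSphere_coe]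

theorem norm_smul_toUnitSphere (x : E3) : ‖x‖ • (toUnitSphere x : E3) = x := by
  by_cases hx : x = 0
  · simp [hx]
  · rw [coe_toUnitSphere hx, smul_inv_smul₀ (norm_ne_zero_iff.2 hx)]

instance : Fact (Module.finrank ℝ E3 = 2 + 1) := ⟨by simp⟩

theorem contMDiffAt_toUnitSphere {x : E3} (hx : x ≠ 0) :
    ContMDiffAt 𝓘(ℝ, E3) (𝓡 2) ∞ toUnitSphere x := by
  have hx' : 0 < ‖x‖ := norm_pos_iff.2 hx
  let χ : ContDiffBump (0 : E3) := ⟨‖x‖ / 4, ‖x‖ / 2, by positivity, by linarith⟩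
  -- `codRestrict_sphere` is applied to a map smooth on all of space. The map `g` is the identity
  -- near `x` and stays within `‖x‖ / 2` of `x`, so `g y / ‖g y‖` is such a map and agrees with the
  -- projection near `x`.
  let g : E3 → E3 := fun y => x + χ (y - x) • (y - x)
  have hg0 : ∀ y, g y ≠ 0 := by
    intro y h
    have h1 : ‖χ (y - x) • (y - x)‖ = ‖x‖ := by
      rw [← norm_neg x, ← eq_neg_of_add_eq_zero_right h]
    have h2 : ‖χ (y - x) • (y - x)‖ ≤ ‖x‖ / 2 := by
      by_cases hy : ‖y - x‖ < ‖x‖ / 2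
      · rw [norm_smul, Real.norm_of_nonneg χ.nonneg]
        exact (mul_le_of_le_one_left (norm_nonneg _) χ.le_one).trans hy.le
      · rw [χ.zero_of_le_dist (by simpa using hy), zero_smul, norm_zero]
        positivity
    linarith
  have hgc : ContDiff ℝ ∞ g := by
    have : ContDiff ℝ ∞ (fun y => χ (y - x)) := χ.contDiff.comp (contDiff_id.sub contDiff_const)
    exact contDiff_const.add (this.smul (contDiff_id.sub contDiff_const))
  have hn : ContDiff ℝ ∞ fun y => ‖g y‖⁻¹ • g y :=
    ((hgc.norm ℝ hg0).inv fun y => norm_ne_zero_iff.2 (hg0 y)).smul hgc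
  have hs : ContMDiff 𝓘(ℝ, E3) (𝓡 2) ∞ (fun y => toUnitSphere (g y)) := by
    have := hn.contMDiff.codRestrict_sphere (n := 2) (fun y => by
      simp [norm_smul, inv_mul_cancel₀ (norm_ne_zero_iff.mpr (hg0 y))])
    refine this.congr fun y => ?_
    ext1
    rw [coe_toUnitSphere (hg0 y)]
    rfl
  refine hs.contMDiffAt.congr_of_eventuallyEq ?_
  filter_upwards [Metric.ball_mem_nhds x (by positivity : 0 < ‖x‖ / 4)] with y hy
  have : χ (y - x) = 1 := χ.one_of_mem_closedBall (by
    simpa [dist_eq_norm] using (mem_ball_iff_norm.1 hy).le)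
  simp [g, this]

theorem continuousAt_toUnitSphere {x : E3} (hx : x ≠ 0) : ContinuousAt toUnitSphere x :=
  (contMDiffAt_toUnitSphere hx).continuousAt

theorem eventually_toUnitSphere_mem {Γ : Set UnitSphere} (hΓ : IsOpen Γ) {ξ : UnitSphere}
    (hξ : ξ ∈ Γ) : ∀ᶠ x in 𝓝 (ξ : E3), x ≠ 0 ∧ toUnitSphere x ∈ Γ :=
  (eventually_ne_nhds (unitSphere_ne_zero ξ)).and <|
    (continuousAt_toUnitSphere (unitSphere_ne_zero ξ)).eventually_mem
      (hΓ.mem_nhds (by simpa using hξ))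

/-- The open cone over a set of directions. -/
def coneOver (Γ : Set UnitSphere) : Set E3 := {x | x ≠ 0 ∧ toUnitSphere x ∈ Γ}

theorem isOpen_coneOver {Γ : Set UnitSphere} (hΓ : IsOpen Γ) : IsOpen (coneOver Γ) := by
  rw [isOpen_iff_mem_nhds]
  rintro x ⟨hx, hxΓ⟩
  exact (eventually_ne_nhds hx).and
    ((continuousAt_toUnitSphere hx).eventually_mem (hΓ.mem_nhds hxΓ))

theorem coe_mem_coneOver {Γ : Set UnitSphere} {ξ : UnitSphere} :
    (ξ : E3) ∈ coneOver Γ ↔ ξ ∈ Γ := by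
  simp [coneOver, unitSphere_ne_zero ξ]

theorem contDiffOn_radialExtension {Γ : Set UnitSphere} (hΓ : IsOpen Γ) {U : UnitSphere → ℝ}
    (hU : ContMDiffOn (𝓡 2) 𝓘(ℝ, ℝ) 2 U Γ) : ContDiffOn ℝ 2 (radialExtension U) (coneOver Γ) := by
  rintro x ⟨hx, hxΓ⟩
  have h1 : ContMDiffAt 𝓘(ℝ, E3) 𝓘(ℝ, ℝ) 2 (U ∘ toUnitSphere) x :=
    (hU.contMDiffAt (hΓ.mem_nhds hxΓ)).comp x ((contMDiffAt_toUnitSphere hx).of_le (by norm_cast))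
  refine (h1.contDiffAt.congr_of_eventuallyEq ?_).contDiffWithinAt
  filter_upwards [eventually_ne_nhds hx] with y hy using radialExtension_eq U hy

theorem contMDiffAt_of_contDiffAt_radialExtension {U : UnitSphere → ℝ} {ξ : UnitSphere}
    (h : ContDiffAt ℝ 2 (radialExtension U) ξ) : ContMDiffAt (𝓡 2) 𝓘(ℝ, ℝ) 2 U ξ := by
  have h1 : ContMDiffAt (𝓡 2) 𝓘(ℝ, ℝ) 2 (radialExtension U ∘ ((↑) : UnitSphere → E3)) ξ :=
    h.contMDiffAt.comp ξ (contMDiff_coe_sphere.contMDiffAt)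
  exact h1.congr_of_eventuallyEq (Eventually.of_forall fun η => (radialExtension_coe U η).symm)

theorem continuousOn_radialExtension {Γ : Set UnitSphere} {U : UnitSphere → ℝ}
    (hU : ContinuousOn U Γ) : ContinuousOn (radialExtension U) (coneOver Γ) := by
  have h1 : ContinuousOn (U ∘ toUnitSphere) (coneOver Γ) :=
    hU.comp (fun x hx => (continuousAt_toUnitSphere hx.1).continuousWithinAt) fun x hx => hx.2
  exact h1.congr fun x hx => radialExtension_eq U hx.1

/-! ### Continuity and differentiation of integrals depending on a parameter. -/

section Parametric

variable {F F' : ℝ → ℝ → ℝ} {I : Set ℝ} {a c t : ℝ}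

theorem continuous_section_of_continuousOn (hF : ContinuousOn (fun p : ℝ × ℝ => F p.1 p.2) (I ×ˢ univ))
    (ht : t ∈ I) : Continuous (F t) := by
  rw [← continuousOn_univ]
  exact hF.comp (f := fun φ => (t, φ)) (by fun_prop) fun φ _ => ⟨ht, mem_univ φ⟩

theorem exists_bound_of_continuousOn (hI : IsOpen I)
    (hF : ContinuousOn (fun p : ℝ × ℝ => F p.1 p.2) (I ×ˢ univ)) (ht : t ∈ I) :
    ∃ C, ∃ s ∈ 𝓝 t, s ⊆ I ∧ ∀ φ ∈ uIcc a c, ∀ x ∈ s, ‖F x φ‖ ≤ C := by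
  obtain ⟨ε, hε, hsub⟩ := Metric.nhds_basis_closedBall.mem_iff.1 (hI.mem_nhds ht)
  obtain ⟨C, hC⟩ := ((isCompact_closedBall t ε).prod isCompact_uIcc).exists_bound_of_continuousOn
    (hF.mono (prod_mono hsub (subset_univ (uIcc a c))))
  exact ⟨C, _, Metric.closedBall_mem_nhds t hε, hsub, fun φ hφ x hx => hC (x, φ) ⟨hx, hφ⟩⟩

theorem continuousAt_parametric_intervalIntegral (hI : IsOpen I)
    (hF : ContinuousOn (fun p : ℝ × ℝ => F p.1 p.2) (I ×ˢ univ)) (ht : t ∈ I) :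
    ContinuousAt (fun x => ∫ φ in a..c, F x φ) t := by
  obtain ⟨C, s, hs, hsI, hC⟩ := exists_bound_of_continuousOn (a := a) (c := c) hI hF ht
  refine intervalIntegral.continuousAt_of_dominated_interval (bound := fun _ => C) ?_ ?_ (by simp) ?_
  · filter_upwards [hI.mem_nhds ht] with x hx
    exact (continuous_section_of_continuousOn hF hx).aestronglyMeasurable
  · filter_upwards [hs] with x hx
    exact ae_of_all _ fun φ hφ => hC φ (uIoc_subset_uIcc hφ) x hx
  · refine ae_of_all _ fun φ _ => ?_
    have h1 := hF.continuousAt ((hI.prod isOpen_univ).mem_nhds (show (t, φ) ∈ I ×ˢ univ from ⟨ht, mem_univ φ⟩))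
    exact h1.comp (f := fun x => (x, φ)) (by fun_prop)

theorem hasDerivAt_parametric_intervalIntegral (hI : IsOpen I)
    (hF : ContinuousOn (fun p : ℝ × ℝ => F p.1 p.2) (I ×ˢ univ))
    (hF' : ContinuousOn (fun p : ℝ × ℝ => F' p.1 p.2) (I ×ˢ univ))
    (hd : ∀ x ∈ I, ∀ φ, HasDerivAt (fun x => F x φ) (F' x φ) x) (ht : t ∈ I) :
    HasDerivAt (fun x => ∫ φ in a..c, F x φ) (∫ φ in a..c, F' t φ) t := by
  obtain ⟨C, s, hs, hsI, hC⟩ := exists_bound_of_continuousOn (a := a) (c := c) hI hF' ht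
  refine (intervalIntegral.hasDerivAt_integral_of_dominated_loc_of_deriv_le (bound := fun _ => C)
    hs ?_ ?_ ?_ ?_ (by simp) ?_).2
  · filter_upwards [hI.mem_nhds ht] with x hx
    exact (continuous_section_of_continuousOn hF hx).aestronglyMeasurable
  · exact (continuous_section_of_continuousOn hF ht).intervalIntegrable _ _
  · exact (continuous_section_of_continuousOn hF' ht).aestronglyMeasurable
  · exact ae_of_all _ fun φ hφ x hx => hC φ (uIoc_subset_uIcc hφ) x hx
  · exact ae_of_all _ fun φ _ x hx => hd x (hsI hx) φ

end Parametric

/-! ### Azimuthal means of functions homogeneous of degree 0. -/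

theorem hasDerivAt_polarPoint (b : OrthonormalBasis (Fin 3) ℝ E3) (θ φ : ℝ) :
    HasDerivAt (fun θ => polarPoint b θ φ) (polarTangent b θ φ) θ :=
  ((hasDerivAt_cos θ).smul_const _).add ((hasDerivAt_sin θ).smul_const _)

theorem hasDerivAt_polarTangent (b : OrthonormalBasis (Fin 3) ℝ E3) (θ φ : ℝ) :
    HasDerivAt (fun θ => polarTangent b θ φ) (-polarPoint b θ φ) θ := by
  have := ((hasDerivAt_sin θ).neg.smul_const (b 0)).add
    ((hasDerivAt_cos θ).smul_const (cos φ • b 1 + sin φ • b 2))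
  refine this.congr_deriv ?_
  unfold polarPoint
  module

theorem hasDerivAt_polarPoint_azimuth (b : OrthonormalBasis (Fin 3) ℝ E3) (θ φ : ℝ) :
    HasDerivAt (fun φ => polarPoint b θ φ) (sin θ • azimuthTangent b φ) φ :=
  ((((hasDerivAt_cos φ).smul_const (b 1)).add ((hasDerivAt_sin φ).smul_const (b 2))).const_smul
    (sin θ)).const_add _

theorem hasDerivAt_azimuthTangent (b : OrthonormalBasis (Fin 3) ℝ E3) (θ φ : ℝ) :
    HasDerivAt (fun φ => azimuthTangent b φ)
      (-(sin θ • polarPoint b θ φ + cos θ • polarTangent b θ φ)) φ := by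
  have := ((hasDerivAt_sin φ).neg.smul_const (b 1)).add ((hasDerivAt_cos φ).smul_const (b 2))
  refine this.congr_deriv ?_
  have h : sin θ • polarPoint b θ φ + cos θ • polarTangent b θ φ =
      (sin θ ^ 2 + cos θ ^ 2) • (cos φ • b 1 + sin φ • b 2) := by
    unfold polarPoint polarTangent; module
  rw [h, sin_sq_add_cos_sq]
  module

theorem continuous_polarTangent (b : OrthonormalBasis (Fin 3) ℝ E3) :
    Continuous (fun p : ℝ × ℝ => polarTangent b p.1 p.2) := by
  unfold polarTangent; fun_prop

theorem laplacian_eq_sum_fderiv {ι : Type*} [Fintype ι] (V : E3 → ℝ)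
    (b : OrthonormalBasis ι ℝ E3) (x : E3) :
    Laplacian.laplacian V x = ∑ i, fderiv ℝ (fderiv ℝ V) x (b i) (b i) := by
  rw [InnerProductSpace.laplacian_eq_iteratedFDeriv_orthonormalBasis V b]
  simp [iteratedFDeriv_two_apply]

section Homogeneous

variable {V : E3 → ℝ} {O : Set E3}

theorem ContDiffOn.hasFDerivAt_of_isOpen (hO : IsOpen O) (hV : ContDiffOn ℝ 2 V O) {x : E3}
    (hx : x ∈ O) : HasFDerivAt V (fderiv ℝ V x) x :=
  ((hV.contDiffAt (hO.mem_nhds hx)).differentiableAt two_ne_zero).hasFDerivAt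

theorem ContDiffOn.hasFDerivAt_fderiv_of_isOpen (hO : IsOpen O) (hV : ContDiffOn ℝ 2 V O) {x : E3}
    (hx : x ∈ O) : HasFDerivAt (fderiv ℝ V) (fderiv ℝ (fderiv ℝ V) x) x :=
  (((hV.fderiv_of_isOpen hO (m := 1) (by norm_num)).contDiffAt (hO.mem_nhds hx)).differentiableAt
    one_ne_zero).hasFDerivAt

theorem ContDiffOn.continuousOn_fderiv_fderiv (hO : IsOpen O) (hV : ContDiffOn ℝ 2 V O) :
    ContinuousOn (fderiv ℝ (fderiv ℝ V)) O :=
  (hV.fderiv_of_isOpen hO (m := 1) (by norm_num)).continuousOn_fderiv_of_isOpen hO le_rfl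

theorem continuousOn_laplacian (hO : IsOpen O) (hV : ContDiffOn ℝ 2 V O) :
    ContinuousOn (Laplacian.laplacian V) O := by
  have h := hV.continuousOn_fderiv_fderiv hO
  refine ContinuousOn.congr ?_ fun x _ => laplacian_eq_sum_fderiv V
    (EuclideanSpace.basisFun (Fin 3) ℝ) x
  exact continuousOn_finsetSum _ fun i _ => (h.clm_apply continuousOn_const).clm_apply
    continuousOn_const

variable (hh : ∀ c : ℝ, 0 < c → ∀ x, V (c • x) = V x)
include hh

/-- Euler's relation in degree 0: `V` is constant along the ray through `x`. -/
theorem fderiv_apply_self_of_homogeneous (hO : IsOpen O) (hV : ContDiffOn ℝ 2 V O) {x : E3}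
    (hx : x ∈ O) : fderiv ℝ V x x = 0 := by
  have h1 : HasDerivAt (fun c : ℝ => V (c • x)) (fderiv ℝ V x x) 1 := by
    have h2 : HasDerivAt (fun c : ℝ => c • x) x 1 := by
      simpa using (hasDerivAt_id (1 : ℝ)).smul_const x
    refine HasFDerivAt.comp_hasDerivAt (1 : ℝ) ?_ h2
    simpa using hV.hasFDerivAt_of_isOpen hO hx
  refine h1.unique ((hasDerivAt_const (1 : ℝ) (V x)).congr_of_eventuallyEq ?_)
  filter_upwards [lt_mem_nhds zero_lt_one] with c hc using hh c hc x

theorem fderiv_fderiv_apply_self_of_homogeneous (hO : IsOpen O) (hV : ContDiffOn ℝ 2 V O) {x : E3}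
    (hx : x ∈ O) : fderiv ℝ (fderiv ℝ V) x x x = 0 := by
  have h2 : HasDerivAt (fun c : ℝ => c • x) x 1 := by
    simpa using (hasDerivAt_id (1 : ℝ)).smul_const x
  have h1 : HasDerivAt (fun c : ℝ => fderiv ℝ V (c • x) x) (fderiv ℝ (fderiv ℝ V) x x x) 1 := by
    have h3 : HasDerivAt (fun c : ℝ => fderiv ℝ V (c • x)) (fderiv ℝ (fderiv ℝ V) x x) 1 := by
      refine HasFDerivAt.comp_hasDerivAt (1 : ℝ) ?_ h2
      simpa using hV.hasFDerivAt_fderiv_of_isOpen hO hx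
    simpa using h3.clm_apply (hasDerivAt_const (1 : ℝ) x)
  refine h1.unique ((hasDerivAt_const (1 : ℝ) (0 : ℝ)).congr_of_eventuallyEq ?_)
  have h4 : ∀ᶠ c in 𝓝 (1 : ℝ), c • x ∈ O :=
    h2.continuousAt.eventually_mem (hO.mem_nhds (by simpa using hx))
  filter_upwards [h4, lt_mem_nhds zero_lt_one] with c hc hc0
  have := fderiv_apply_self_of_homogeneous hh hO hV hc
  simpa [hc0.ne'] using this

variable (b : OrthonormalBasis (Fin 3) ℝ E3)

theorem laplacian_polarPoint_of_homogeneous (hO : IsOpen O) (hV : ContDiffOn ℝ 2 V O) {θ φ : ℝ}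
    (hx : polarPoint b θ φ ∈ O) : Laplacian.laplacian V (polarPoint b θ φ) =
      fderiv ℝ (fderiv ℝ V) (polarPoint b θ φ) (polarTangent b θ φ) (polarTangent b θ φ) +
      fderiv ℝ (fderiv ℝ V) (polarPoint b θ φ) (azimuthTangent b φ) (azimuthTangent b φ) := by
  rw [laplacian_eq_sum_fderiv V (polarFrame b θ φ), Fin.sum_univ_three, polarFrame_zero,
    polarFrame_one, polarFrame_two, fderiv_fderiv_apply_self_of_homogeneous hh hO hV hx, zero_add]

variable {I : Set ℝ}

omit hh in
theorem hasDerivAt_azimuthalMean (hI : IsOpen I) (hO : IsOpen O) (hV : ContDiffOn ℝ 2 V O)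
    (hmem : ∀ θ ∈ I, ∀ φ, polarPoint b θ φ ∈ O) {θ : ℝ} (hθ : θ ∈ I) :
    HasDerivAt (fun θ => ∫ φ in 0..2 * π, V (polarPoint b θ φ))
      (∫ φ in 0..2 * π, fderiv ℝ V (polarPoint b θ φ) (polarTangent b θ φ)) θ := by
  have hm : MapsTo (fun p : ℝ × ℝ => polarPoint b p.1 p.2) (I ×ˢ univ) O :=
    fun p hp => hmem p.1 hp.1 p.2
  have hP := (continuous_polarPoint b).continuousOn (s := I ×ˢ univ)
  refine hasDerivAt_parametric_intervalIntegral
    (F := fun θ φ => V (polarPoint b θ φ))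
    (F' := fun θ φ => fderiv ℝ V (polarPoint b θ φ) (polarTangent b θ φ)) hI (hV.continuousOn.comp hP hm) ?_ ?_ hθ
  · exact ((hV.continuousOn_fderiv_of_isOpen hO (by norm_num)).comp hP hm).clm_apply
      (continuous_polarTangent b).continuousOn
  · intro x hx φ
    exact (hV.hasFDerivAt_of_isOpen hO (hmem x hx φ)).comp_hasDerivAt x (hasDerivAt_polarPoint b x φ)

/-- With `T` and `S` the first and second derivatives of `V` along the meridian, the derivative of
`sin θ · T` is `cos θ · T + sin θ · S`. This differs from `sin θ · ΔV` by an exact azimuthal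
derivative, which integrates to zero over a period. -/
theorem hasDerivAt_azimuthalFlux (hI : IsOpen I) (hO : IsOpen O) (hV : ContDiffOn ℝ 2 V O)
    (hmem : ∀ θ ∈ I, ∀ φ, polarPoint b θ φ ∈ O) {θ : ℝ} (hθ : θ ∈ I) :
    HasDerivAt (fun θ => sin θ *
        ∫ φ in 0..2 * π, fderiv ℝ V (polarPoint b θ φ) (polarTangent b θ φ))
      (sin θ * ∫ φ in 0..2 * π, Laplacian.laplacian V (polarPoint b θ φ)) θ := by
  have hm : MapsTo (fun p : ℝ × ℝ => polarPoint b p.1 p.2) (I ×ˢ univ) O :=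
    fun p hp => hmem p.1 hp.1 p.2
  have hP := (continuous_polarPoint b).continuousOn (s := I ×ˢ univ)
  have hT := (continuous_polarTangent b).continuousOn (s := I ×ˢ univ)
  have hA : ContinuousOn (fun p : ℝ × ℝ => fderiv ℝ V (polarPoint b p.1 p.2)) (I ×ˢ univ) :=
    (hV.continuousOn_fderiv_of_isOpen hO (by norm_num)).comp hP hm
  have hB : ContinuousOn (fun p : ℝ × ℝ => fderiv ℝ (fderiv ℝ V) (polarPoint b p.1 p.2))
      (I ×ˢ univ) := (hV.continuousOn_fderiv_fderiv hO).comp hP hm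
  have hL : ContinuousOn (fun p : ℝ × ℝ => Laplacian.laplacian V (polarPoint b p.1 p.2))
      (I ×ˢ univ) := (continuousOn_laplacian hO hV).comp hP hm
  set S : ℝ → ℝ → ℝ := fun θ φ =>
    fderiv ℝ (fderiv ℝ V) (polarPoint b θ φ) (polarTangent b θ φ) (polarTangent b θ φ) with hS
  set T : ℝ → ℝ → ℝ := fun θ φ => fderiv ℝ V (polarPoint b θ φ) (polarTangent b θ φ) with hTdef
  have hSc : ContinuousOn (fun p : ℝ × ℝ => S p.1 p.2) (I ×ˢ univ) :=
    (hB.clm_apply hT).clm_apply hT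
  have hTc : ContinuousOn (fun p : ℝ × ℝ => T p.1 p.2) (I ×ˢ univ) := hA.clm_apply hT
  have hdT : ∀ x ∈ I, ∀ φ, HasDerivAt (fun x => T x φ) (S x φ) x := by
    intro x hx φ
    have h1 := (hV.hasFDerivAt_fderiv_of_isOpen hO (hmem x hx φ)).comp_hasDerivAt x
      (hasDerivAt_polarPoint b x φ)
    refine (h1.clm_apply (hasDerivAt_polarTangent b x φ)).congr_deriv ?_
    -- The tangent turns towards `-polarPoint`, a radial direction, so Euler's relation removes that
    -- term.
    simp [hS, fderiv_apply_self_of_homogeneous hh hO hV (hmem x hx φ)]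
  have key : ∫ φ in 0..2 * π, (sin θ * Laplacian.laplacian V (polarPoint b θ φ) -
      (cos θ * T θ φ + sin θ * S θ φ)) = 0 := by
    have hd : ∀ φ, HasDerivAt (fun φ => fderiv ℝ V (polarPoint b θ φ) (azimuthTangent b φ))
        (sin θ * Laplacian.laplacian V (polarPoint b θ φ) -
          (cos θ * T θ φ + sin θ * S θ φ)) φ := by
      intro φ
      have hx := hmem θ hθ φ
      have h1 := (hV.hasFDerivAt_fderiv_of_isOpen hO hx).comp_hasDerivAt φ
        (hasDerivAt_polarPoint_azimuth b θ φ)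
      refine (h1.clm_apply (hasDerivAt_azimuthTangent b θ φ)).congr_deriv ?_
      rw [laplacian_polarPoint_of_homogeneous hh b hO hV hx]
      simp only [hS, hTdef, map_smul, smul_apply, smul_eq_mul, map_neg, map_add]
      simp only [Function.comp_apply, fderiv_apply_self_of_homogeneous hh hO hV hx]
      ring
    rw [intervalIntegral.integral_eq_sub_of_hasDerivAt (fun φ _ => hd φ)]
    · simp [polarPoint, azimuthTangent]
    · refine Continuous.intervalIntegrable ?_ _ _
      have h1 := continuous_section_of_continuousOn
        (F := fun θ φ => Laplacian.laplacian V (polarPoint b θ φ)) hL hθ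
      have h2 := continuous_section_of_continuousOn hTc hθ
      have h3 := continuous_section_of_continuousOn hSc hθ
      exact (continuous_const.mul h1).sub ((continuous_const.mul h2).add (continuous_const.mul h3))
  have hLi : IntervalIntegrable (fun φ => Laplacian.laplacian V (polarPoint b θ φ)) volume 0
      (2 * π) := (continuous_section_of_continuousOn
        (F := fun θ φ => Laplacian.laplacian V (polarPoint b θ φ)) hL hθ).intervalIntegrable _ _
  have hTi := (continuous_section_of_continuousOn hTc hθ).intervalIntegrable (μ := volume) 0 (2 * π)
  have hSi := (continuous_section_of_continuousOn hSc hθ).intervalIntegrable (μ := volume) 0 (2 * π)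
  rw [intervalIntegral.integral_sub (hLi.const_mul _) ((hTi.const_mul _).add (hSi.const_mul _)),
    intervalIntegral.integral_add (hTi.const_mul _) (hSi.const_mul _),
    intervalIntegral.integral_const_mul, intervalIntegral.integral_const_mul,
    intervalIntegral.integral_const_mul] at key
  refine ((hasDerivAt_sin θ).mul
    (hasDerivAt_parametric_intervalIntegral (a := 0) (c := 2 * π) hI hTc hSc hdT hθ)).congr_deriv ?_
  linarith

/-- The azimuthal mean of a harmonic homogeneous function equals its value on the axis. -/
theorem azimuthalMean_eq_of_laplacian_eq_zero {R : ℝ} (hO : IsOpen O)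
    (hV : ContDiffOn ℝ 2 V O) (hmem : ∀ θ ∈ Ioo (-R) R, ∀ φ, polarPoint b θ φ ∈ O)
    (h0 : ∀ θ ∈ Ioo (-R) R, ∀ φ, Laplacian.laplacian V (polarPoint b θ φ) = 0) {θ : ℝ}
    (hθ0 : 0 ≤ θ) (hθπ : θ < π) (hθ : θ < R) :
    ∫ φ in 0..2 * π, V (polarPoint b θ φ) = 2 * π * V (b 0) := by
  have hsub : ∀ x ∈ Icc 0 θ, x ∈ Ioo (-R) R := fun x hx =>
    ⟨by linarith [hx.1], by linarith [hx.2]⟩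
  -- The flux has derivative zero and vanishes at the pole because `sin 0 = 0`.
  have hflux : ∀ x ∈ Icc 0 θ, sin x *
      ∫ φ in 0..2 * π, fderiv ℝ V (polarPoint b x φ) (polarTangent b x φ) = 0 := by
    intro x hx
    have hd : ∀ y ∈ Icc 0 θ, HasDerivAt (fun θ => sin θ *
        ∫ φ in 0..2 * π, fderiv ℝ V (polarPoint b θ φ) (polarTangent b θ φ)) 0 y := by
      intro y hy
      refine (hasDerivAt_azimuthalFlux hh b isOpen_Ioo hO hV hmem (hsub y hy)).congr_deriv ?_
      simp [h0 y (hsub y hy)]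
    have := constant_of_has_deriv_right_zero (fun y hy => (hd y hy).continuousAt.continuousWithinAt)
      (fun y hy => (hd y (Ico_subset_Icc_self hy)).hasDerivWithinAt) x hx
    simpa using this
  have hd : ∀ y ∈ Icc 0 θ, HasDerivAt (fun θ => ∫ φ in 0..2 * π, V (polarPoint b θ φ))
      (∫ φ in 0..2 * π, fderiv ℝ V (polarPoint b y φ) (polarTangent b y φ)) y :=
    fun y hy => hasDerivAt_azimuthalMean b isOpen_Ioo hO hV hmem (hsub y hy)
  have hc : ContinuousOn (fun θ => ∫ φ in 0..2 * π, V (polarPoint b θ φ)) (Icc 0 θ) :=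
    fun y hy => (hd y hy).continuousAt.continuousWithinAt
  -- Only interior points: the factor `sin y` cannot be cancelled at the pole.
  have hd' : ∀ y ∈ interior (Icc 0 θ),
      HasDerivAt (fun θ => ∫ φ in 0..2 * π, V (polarPoint b θ φ)) 0 y := by
    intro y hy
    rw [interior_Icc] at hy
    refine (hd y (Ioo_subset_Icc_self hy)).congr_deriv ?_
    have hs : 0 < sin y := sin_pos_of_pos_of_lt_pi hy.1 (hy.2.trans hθπ)
    exact (mul_eq_zero.1 (hflux y (Ioo_subset_Icc_self hy))).resolve_left hs.ne'
  have h1 : (∫ φ in 0..2 * π, V (polarPoint b θ φ)) = ∫ φ in 0..2 * π, V (polarPoint b 0 φ) := by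
    have hdo : DifferentiableOn ℝ (fun θ => ∫ φ in 0..2 * π, V (polarPoint b θ φ))
        (interior (Icc 0 θ)) := fun y hy => (hd' y hy).differentiableAt.differentiableWithinAt
    exact le_antisymm
      (antitoneOn_of_deriv_nonpos (convex_Icc 0 θ) hc hdo (fun y hy => (hd' y hy).deriv.le)
        (left_mem_Icc.2 hθ0) (right_mem_Icc.2 hθ0) hθ0)
      (monotoneOn_of_deriv_nonneg (convex_Icc 0 θ) hc hdo (fun y hy => (hd' y hy).deriv.ge)
        (left_mem_Icc.2 hθ0) (right_mem_Icc.2 hθ0) hθ0)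
  rw [h1]
  simp [polarPoint]

/-- If the azimuthal means near the axis do not depend on the polar angle, then the Laplacian
vanishes on the axis. -/
theorem laplacian_eq_zero_of_azimuthalMean_eq {R C : ℝ} (hR : 0 < R) (hRπ : R ≤ π) (hO : IsOpen O)
    (hV : ContDiffOn ℝ 2 V O) (hmem : ∀ θ ∈ Ioo (-R) R, ∀ φ, polarPoint b θ φ ∈ O)
    (hC : ∀ θ ∈ Ioo 0 R, ∫ φ in 0..2 * π, V (polarPoint b θ φ) = C) :
    Laplacian.laplacian V (b 0) = 0 := by
  have hsub : ∀ x ∈ Ioo 0 R, x ∈ Ioo (-R) R := fun x hx =>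
    ⟨by linarith [hx.1], by linarith [hx.2]⟩
  have hN : ∀ x ∈ Ioo 0 R,
      ∫ φ in 0..2 * π, fderiv ℝ V (polarPoint b x φ) (polarTangent b x φ) = 0 := by
    intro x hx
    refine (hasDerivAt_azimuthalMean b isOpen_Ioo hO hV hmem (hsub x hx)).unique
      ((hasDerivAt_const x C).congr_of_eventuallyEq ?_)
    filter_upwards [isOpen_Ioo.mem_nhds hx] with y hy using hC y hy
  have hL : ∀ x ∈ Ioo 0 R, ∫ φ in 0..2 * π, Laplacian.laplacian V (polarPoint b x φ) = 0 := by
    intro x hx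
    have h1 := (hasDerivAt_azimuthalFlux hh b isOpen_Ioo hO hV hmem (hsub x hx)).unique
      ((hasDerivAt_const x (0 : ℝ)).congr_of_eventuallyEq (by
        filter_upwards [isOpen_Ioo.mem_nhds hx] with y hy
        simp [hN y hy]))
    have hs : 0 < sin x := sin_pos_of_pos_of_lt_pi hx.1 (hx.2.trans_le hRπ)
    exact (mul_eq_zero.1 h1).resolve_left hs.ne'
  -- Cancelling `sin x` was possible only off the axis; continuity carries the result to `x = 0`,
  -- where the integrand is constant in `φ`.
  have hcont : ContinuousAt (fun x => ∫ φ in 0..2 * π, Laplacian.laplacian V (polarPoint b x φ)) 0 :=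
    continuousAt_parametric_intervalIntegral (isOpen_Ioo (a := -R) (b := R))
      ((continuousOn_laplacian hO hV).comp (continuous_polarPoint b).continuousOn
        fun p hp => hmem p.1 hp.1 p.2) ⟨by linarith, hR⟩
  have h2 : ∫ φ in 0..2 * π, Laplacian.laplacian V (polarPoint b 0 φ) = 0 := by
    refine tendsto_nhds_unique (hcont.tendsto.mono_left (nhdsWithin_le_nhds (s := Ioi 0)))
      (tendsto_const_nhds.congr' ?_)
    filter_upwards [Ioo_mem_nhdsGT hR] with x hx using (hL x hx).symm
  simpa [polarPoint, pi_ne_zero] using h2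

end Homogeneous

/-! ### Rotations about an axis. -/

/-- The rotation by the angle `φ` about the axis `b 0`. -/
def axisRotation (b : OrthonormalBasis (Fin 3) ℝ E3) (φ : ℝ) : E3 ≃ₗᵢ[ℝ] E3 :=
  b.equiv (polarFrame b 0 φ) (Equiv.refl _)

section Rotation

variable (b : OrthonormalBasis (Fin 3) ℝ E3)

theorem axisRotation_basis (φ : ℝ) (i : Fin 3) : axisRotation b φ (b i) = polarFrame b 0 φ i := by
  simp [axisRotation]

theorem axisRotation_axis (φ : ℝ) : axisRotation b φ (b 0) = b 0 := by
  rw [axisRotation_basis, polarFrame_zero]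
  simp [polarPoint]

theorem axisRotation_polarPoint (φ θ α : ℝ) :
    axisRotation b φ (polarPoint b θ α) = polarPoint b θ (α + φ) := by
  rw [polarPoint_eq, polarPoint_eq]
  simp only [map_add, map_smul, axisRotation_basis, polarFrame_zero, polarFrame_one, polarFrame_two]
  simp only [polarPoint, polarTangent, azimuthTangent, cos_zero, sin_zero, cos_add, sin_add]
  module

theorem continuous_axisRotation : Continuous (fun p : ℝ × E3 => axisRotation b p.1 p.2) := by
  have h : ∀ p : ℝ × E3, axisRotation b p.1 p.2 = ∑ i, ⟪b i, p.2⟫ • polarFrame b 0 p.1 i := by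
    intro p
    conv_lhs => rw [← b.sum_repr' p.2, map_sum]
    simp only [map_smul, axisRotation_basis]
  simp only [h, Fin.sum_univ_three, polarFrame_zero, polarFrame_one, polarFrame_two]
  unfold polarPoint polarTangent azimuthTangent
  fun_prop

end Rotation

/-! ### Regularity: the mean value property makes the radial extension its own mollification. -/

theorem dist_sq_unitSphere (ξ η : UnitSphere) : dist ξ η ^ 2 = 2 - 2 * ⟪(ξ : E3), (η : E3)⟫ := by
  rw [Subtype.dist_eq, dist_eq_norm, norm_sub_sq_real]
  simp
  ring

/-- The mean value property over circles, in terms of an azimuthal parametrization. -/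
def HasAzimuthalMeanValue (U : UnitSphere → ℝ) (Γ : Set UnitSphere) : Prop :=
  ∀ ξ ∈ Γ, ∀ b : OrthonormalBasis (Fin 3) ℝ E3, b 0 = ξ → ∀ θ ∈ Ioo 0 π,
    (∀ η : UnitSphere, cos θ ≤ ⟪(ξ : E3), (η : E3)⟫ → η ∈ Γ) →
    ∫ φ in 0..2 * π, U (spherePoint b θ φ) = 2 * π * U ξ

/-- The rotated `y` projects to the circle about the direction of `x` through that of `y`. The two
directions are less than `2 * δ` apart, so the closed cap bounded by this circle stays in the ball
of radius `3 * δ`. -/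
theorem HasAzimuthalMeanValue.integral_axisRotation {Γ : Set UnitSphere} {U : UnitSphere → ℝ}
    (h : HasAzimuthalMeanValue U Γ) {ξ : UnitSphere} {δ : ℝ} (hδ : δ ≤ 1)
    (hball : Metric.ball ξ (3 * δ) ⊆ Γ) {x y : E3} (hx0 : x ≠ 0) (hy0 : y ≠ 0)
    (hx : toUnitSphere x ∈ Metric.ball ξ δ) (hy : toUnitSphere y ∈ Metric.ball ξ δ)
    {b : OrthonormalBasis (Fin 3) ℝ E3} (hb : b 0 = toUnitSphere x) :
    ∫ φ in 0..2 * π, radialExtension U (axisRotation b φ y) = 2 * π * radialExtension U x := by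
  rw [Metric.mem_ball] at hx hy
  have hδ0 : 0 < δ := dist_nonneg.trans_lt hx
  obtain ⟨θ, hθ, α, hyθ⟩ := exists_eq_norm_smul_polarPoint b y
  have hyn : 0 < ‖y‖ := norm_pos_iff.2 hy0
  have hyS : toUnitSphere y = spherePoint b θ α := by
    rw [hyθ, toUnitSphere_smul hyn, ← coe_spherePoint, toUnitSphere_coe]
  have hcos : ⟪(toUnitSphere x : E3), (toUnitSphere y : E3)⟫ = cos θ := by
    rw [hyS, ← hb, coe_spherePoint, inner_axis_polarPoint]
  have hxy : dist (toUnitSphere x) (toUnitSphere y) < 2 * δ := by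
    linarith [dist_triangle_right (toUnitSphere x) (toUnitSphere y) ξ]
  have hrot : ∀ φ, radialExtension U (axisRotation b φ y) = U (spherePoint b θ (φ + α)) := by
    intro φ
    rw [radialExtension_eq U (by simpa using hy0)]
    conv_lhs => rw [hyθ, map_smul, toUnitSphere_smul hyn, axisRotation_polarPoint,
      ← coe_spherePoint, toUnitSphere_coe]
    rw [add_comm]
  simp only [hrot]
  rw [radialExtension_eq U hx0]
  rcases hθ.1.eq_or_lt with rfl | hθ0
  · have : ∀ φ, spherePoint b 0 φ = toUnitSphere x := fun φ => by
      ext1; simp [polarPoint, hb]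
    simp [this]
  -- Antipodal directions are at distance 2, which `2 * δ ≤ 2` rules out.
  have hθπ : θ < π := by
    refine hθ.2.lt_of_ne ?_
    rintro rfl
    have := dist_sq_unitSphere (toUnitSphere x) (toUnitSphere y)
    rw [hcos, cos_pi] at this
    nlinarith [dist_nonneg (x := toUnitSphere x) (y := toUnitSphere y)]
  rw [intervalIntegral.integral_comp_add_right (fun t => U (spherePoint b θ t)) α]
  have hper : Function.Periodic (fun t => U (spherePoint b θ t)) (2 * π) :=
    (periodic_spherePoint b θ).comp U
  have hshift := hper.intervalIntegral_add_eq (0 + α) 0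
  rw [show 2 * π + α = 0 + α + 2 * π by ring, hshift, zero_add]
  refine h _ (hball (Metric.mem_ball.2 (by linarith))) b hb θ ⟨hθ0, hθπ⟩ fun η hη => hball ?_
  have h1 : dist (toUnitSphere x) η ≤ dist (toUnitSphere x) (toUnitSphere y) := by
    refine (pow_le_pow_iff_left₀ dist_nonneg dist_nonneg two_ne_zero).1 ?_
    rw [dist_sq_unitSphere, dist_sq_unitSphere, hcos]
    linarith
  rw [Metric.mem_ball]
  linarith [dist_triangle_left η ξ (toUnitSphere x)]

/-- A smooth radial function, positive exactly on the ball of radius `r`. -/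
def radialBump (r : ℝ) (y : E3) : ℝ := Real.smoothTransition (r ^ 2 - ‖y‖ ^ 2)

theorem contDiff_radialBump (r : ℝ) : ContDiff ℝ 2 (radialBump r) :=
  Real.smoothTransition.contDiff.comp (contDiff_const.sub (contDiff_norm_sq ℝ))

theorem radialBump_eq_zero {r : ℝ} {y : E3} (hr : 0 ≤ r) (hy : r ≤ ‖y‖) : radialBump r y = 0 :=
  Real.smoothTransition.zero_of_nonpos (by nlinarith)

theorem hasCompactSupport_radialBump {r : ℝ} (hr : 0 ≤ r) : HasCompactSupport (radialBump r) :=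
  HasCompactSupport.intro (isCompact_closedBall (0 : E3) r) fun y hy =>
    radialBump_eq_zero hr (by simpa using (not_le.1 (by simpa using hy)).le)

theorem integral_radialBump_pos {r : ℝ} (hr : 0 < r) : 0 < ∫ y, radialBump r y :=
  (contDiff_radialBump r).continuous.integral_pos_of_hasCompactSupport_nonneg_nonzero
    (hasCompactSupport_radialBump hr.le) (fun _ => Real.smoothTransition.nonneg _) (x := 0)
    (Real.smoothTransition.pos_of_pos (by simpa using by positivity)).ne'

/-- A function whose mean over rotations about the axis through `x` is constant near `x` is
reproduced at `x` by convolution with a radial bump function. -/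
theorem integral_mul_radialBump_eq {r : ℝ} (hr : 0 < r) {f : E3 → ℝ} (hf : Continuous f) {x : E3}
    {m : ℝ} (b : OrthonormalBasis (Fin 3) ℝ E3) (hb : ∀ φ, axisRotation b φ x = x)
    (hm : ∀ y, ‖x - y‖ < r → ∫ φ in 0..2 * π, f (axisRotation b φ y) = 2 * π * m) :
    ∫ y, f y * radialBump r (x - y) = m * ∫ y, radialBump r y := by
  have hg := (contDiff_radialBump r).continuous
  set H : ℝ → E3 → ℝ := fun φ y => f (axisRotation b φ y) * radialBump r (x - y) with hH
  have hHc : Continuous (fun p : ℝ × E3 => H p.1 p.2) :=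
    (hf.comp (continuous_axisRotation b)).mul (hg.comp (by fun_prop))
  have hrot : ∀ φ, ∫ y, f y * radialBump r (x - y) = ∫ y, H φ y := by
    intro φ
    -- The rotation preserves volume and, fixing `x`, also the distance to `x`; hence only the
    -- factor `f` changes.
    rw [← (axisRotation b φ).measurePreserving.integral_comp
      (axisRotation b φ).toHomeomorph.measurableEmbedding]
    refine integral_congr_ae (ae_of_all _ fun y => ?_)
    have : ‖x - axisRotation b φ y‖ = ‖x - y‖ := by
      conv_lhs => rw [← hb φ, ← map_sub, LinearIsometryEquiv.norm_map]
    simp only [hH, radialBump, this]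
  have hzero : ∀ φ, ∀ y ∉ Metric.closedBall x r, H φ y = 0 := by
    intro φ y hy
    rw [Metric.mem_closedBall, not_le, dist_eq_norm, norm_sub_rev] at hy
    simp only [hH, radialBump_eq_zero hr.le hy.le, mul_zero]
  have hint : Integrable (Function.uncurry H) ((volume.restrict (Ioc 0 (2 * π))).prod
      (volume.restrict (Metric.closedBall x r))) := by
    rw [Measure.prod_restrict]
    have : IntegrableOn (Function.uncurry H) (Icc 0 (2 * π) ×ˢ Metric.closedBall x r)
        (volume.prod volume) :=
      hHc.continuousOn.integrableOn_compact (isCompact_Icc.prod (isCompact_closedBall x r))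
    exact this.mono_set (prod_mono Ioc_subset_Icc_self Subset.rfl)
  have hswap : ∫ φ in 0..2 * π, ∫ y, H φ y = ∫ y, ∫ φ in 0..2 * π, H φ y := by
    rw [← setIntegral_eq_integral_of_forall_compl_eq_zero (s := Metric.closedBall x r)
      (f := fun y => ∫ φ in 0..2 * π, H φ y) (fun y hy => by simp [hzero _ y hy])]
    have : ∀ φ, ∫ y, H φ y = ∫ y in Metric.closedBall x r, H φ y := fun φ =>
      (setIntegral_eq_integral_of_forall_compl_eq_zero (hzero φ)).symm
    simp only [this, intervalIntegral.integral_of_le two_pi_pos.le]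
    exact integral_integral_swap hint
  have hinner : ∀ y, ∫ φ in 0..2 * π, H φ y = 2 * π * m * radialBump r (x - y) := by
    intro y
    rw [hH, intervalIntegral.integral_mul_const]
    by_cases hy : ‖x - y‖ < r
    · rw [hm y hy]
    · rw [radialBump_eq_zero hr.le (not_lt.1 hy), mul_zero, mul_zero]
  have h1 : 2 * π * ∫ y, f y * radialBump r (x - y) = 2 * π * (m * ∫ y, radialBump r y) := by
    calc 2 * π * ∫ y, f y * radialBump r (x - y)
        = ∫ φ in 0..2 * π, ∫ y, H φ y := by simp [← hrot]
      _ = ∫ y, 2 * π * m * radialBump r (x - y) := by rw [hswap]; simp only [hinner]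
      _ = 2 * π * (m * ∫ y, radialBump r y) := by
        rw [integral_const_mul, integral_sub_left_eq_self (radialBump r) volume x, mul_assoc]
  exact mul_left_cancel₀ two_pi_pos.ne' h1

theorem HasAzimuthalMeanValue.contDiffAt {Γ : Set UnitSphere} (hΓ : IsOpen Γ)
    {U : UnitSphere → ℝ} (hU : ContinuousOn U Γ) (h : HasAzimuthalMeanValue U Γ) {ξ : UnitSphere}
    (hξ : ξ ∈ Γ) : ContDiffAt ℝ 2 (radialExtension U) (ξ : E3) := by
  obtain ⟨ε, hε, hεΓ⟩ := Metric.isOpen_iff.1 hΓ ξ hξ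
  obtain ⟨δ, hδ0, hδ1, hδε⟩ : ∃ δ : ℝ, 0 < δ ∧ δ ≤ 1 ∧ 3 * δ ≤ ε :=
    ⟨min 1 (ε / 3), by positivity, min_le_left _ _, by linarith [min_le_right 1 (ε / 3)]⟩
  have hball : Metric.ball ξ (3 * δ) ⊆ Γ := (Metric.ball_subset_ball hδε).trans hεΓ
  obtain ⟨r, hr, hsub⟩ := Metric.eventually_nhds_iff_ball.1
    (eventually_toUnitSphere_mem Metric.isOpen_ball (Metric.mem_ball_self hδ0 : ξ ∈ Metric.ball ξ δ))
  obtain ⟨s, hs, hsr⟩ : ∃ s : ℝ, 0 < s ∧ 2 * s < r := ⟨r / 3, by positivity, by linarith⟩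
  have hK : ContinuousOn (radialExtension U) (Metric.closedBall (ξ : E3) (2 * s)) := by
    refine (continuousOn_radialExtension hU).mono fun x hx => ?_
    have := hsub x (Metric.closedBall_subset_ball hsr hx)
    exact ⟨this.1, hball (Metric.ball_subset_ball (by linarith) this.2)⟩
  -- Tietze extension supplies a globally continuous function to convolve. For `x` within `s` of `ξ`
  -- the bump of radius `s` sees only the ball of radius `2 * s`, where `f` is the radial extension.
  obtain ⟨f, hf⟩ := ContinuousMap.exists_restrict_eq (Metric.isClosed_closedBall)
    (⟨_, hK.domRestrict⟩ : C(Metric.closedBall (ξ : E3) (2 * s), ℝ))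
  have hfV : ∀ y ∈ Metric.closedBall (ξ : E3) (2 * s), f y = radialExtension U y := fun y hy =>
    DFunLike.congr_fun hf ⟨y, hy⟩
  have hpos := integral_radialBump_pos hs
  have hconv : ∀ x ∈ Metric.ball (ξ : E3) s, radialExtension U x =
      (convolution f (radialBump s) (ContinuousLinearMap.mul ℝ ℝ) volume) x /
        ∫ y, radialBump s y := by
    intro x hx
    rw [Metric.mem_ball] at hx
    have hx' := hsub x (Metric.mem_ball.2 (by linarith))
    obtain ⟨b, hb⟩ := exists_orthonormalBasis_zero_eq (toUnitSphere x)
    have hfix : ∀ φ, axisRotation b φ x = x := fun φ => by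
      conv_lhs => rw [← norm_smul_toUnitSphere x, map_smul, ← hb, axisRotation_axis, hb,
        norm_smul_toUnitSphere]
    have key := integral_mul_radialBump_eq (m := radialExtension U x) hs f.continuous b hfix
      fun y hy => by
        rw [norm_sub_rev, ← dist_eq_norm] at hy
        have hy' := hsub y (Metric.mem_ball.2 (by linarith [dist_triangle y x (ξ : E3)]))
        rw [← h.integral_axisRotation hδ1 hball hx'.1 hy'.1 hx'.2 hy'.2 hb]
        refine intervalIntegral.integral_congr fun φ _ => hfV _ ?_
        have h1 : dist (axisRotation b φ y) x = dist y x := by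
          conv_lhs => rw [← hfix φ, LinearIsometryEquiv.dist_map]
        rw [Metric.mem_closedBall]
        linarith [dist_triangle (axisRotation b φ y) x (ξ : E3)]
    rw [eq_div_iff hpos.ne', ← key]
    rfl
  have hsm : ContDiff ℝ 2 (convolution f (radialBump s) (ContinuousLinearMap.mul ℝ ℝ) volume) :=
    (hasCompactSupport_radialBump hs.le).contDiff_convolution_right (n := 2) _
      f.continuous.locallyIntegrable (contDiff_radialBump s)
  refine (hsm.div_const (∫ y, radialBump s y)).contDiffAt.congr_of_eventuallyEq ?_
  filter_upwards [Metric.ball_mem_nhds (ξ : E3) hs] with x hx using hconv x hx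

/-! ### The two implications. -/

theorem radialExtension_smul (U : UnitSphere → ℝ) (c : ℝ) (hc : 0 < c) (x : E3) :
    radialExtension U (c • x) = radialExtension U x := by
  by_cases hx : x = 0
  · simp [hx]
  · rw [radialExtension_eq U hx, radialExtension_eq U (smul_ne_zero hc.ne' hx),
      toUnitSphere_smul hc]

theorem BeltramiHarmonicOn.hasAzimuthalMeanValue {Γ : Set UnitSphere} (hΓ : IsOpen Γ)
    {U : UnitSphere → ℝ} (h : BeltramiHarmonicOn U Γ) : HasAzimuthalMeanValue U Γ := by
  intro ξ hξ b hb θ hθ hcap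
  have hcont := continuous_spherePoint b
  have hmem : ∀ t ∈ Icc 0 θ, ∀ φ, spherePoint b t φ ∈ Γ := by
    intro t ht φ
    have h1 : cos θ ≤ ⟪(ξ : E3), (spherePoint b t φ : E3)⟫ := by
      rw [← hb, coe_spherePoint, inner_axis_polarPoint]
      exact cos_le_cos_of_nonneg_of_le_pi ht.1 hθ.2.le ht.2
    exact hcap (spherePoint b t φ) h1
  have hper : ∀ t φ, ∃ ψ ∈ Icc 0 (2 * π), spherePoint b t φ = spherePoint b t ψ := by
    intro t φ
    obtain ⟨ψ, hψ, e⟩ := (periodic_spherePoint b t).exists_mem_Ioc two_pi_pos φ 0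
    exact ⟨ψ, Ioc_subset_Icc_self (by simpa using hψ), e⟩
  -- The differential argument needs an open range of angles containing `θ`; compactness of the
  -- boundary circle and openness of `Γ` provide it.
  have hev : ∀ᶠ t in 𝓝 θ, ∀ φ ∈ Icc 0 (2 * π), spherePoint b t φ ∈ Γ :=
    isCompact_Icc.eventually_forall_of_forall_eventually fun φ _ => by
      have hlim : Tendsto (fun z : ℝ × ℝ => spherePoint b z.1 z.2) (𝓝 (θ, φ))
          (𝓝 (spherePoint b θ φ)) := hcont.tendsto (θ, φ)
      exact hlim.eventually_mem (hΓ.mem_nhds (hmem θ ⟨hθ.1.le, le_rfl⟩ φ))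
  obtain ⟨ε, hε, hεb⟩ := Metric.eventually_nhds_iff_ball.1 hev
  have hpos : ∀ t, 0 ≤ t → t < θ + ε → ∀ φ, spherePoint b t φ ∈ Γ := by
    intro t h0 h1 φ
    rcases le_or_gt t θ with h2 | h2
    · exact hmem t ⟨h0, h2⟩ φ
    · obtain ⟨ψ, hψ, e⟩ := hper t φ
      rw [e]
      exact hεb t (by rw [Metric.mem_ball, Real.dist_eq, abs_of_pos] <;> linarith) ψ hψ
  have hall : ∀ t ∈ Ioo (-(θ + ε)) (θ + ε), ∀ φ, spherePoint b t φ ∈ Γ := by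
    intro t ht φ
    rcases le_total 0 t with h0 | h0
    · exact hpos t h0 ht.2 φ
    -- Negative angles, needed for two-sided derivatives at the pole, describe the same points with
    -- opposite azimuth.
    · have : spherePoint b t φ = spherePoint b (-t) (φ + π) := by
        ext1
        simp only [coe_spherePoint, polarPoint, cos_neg, sin_neg, cos_add_pi, sin_add_pi]
        module
      rw [this]
      exact hpos (-t) (by linarith) (by linarith [ht.1]) _
  have key := azimuthalMean_eq_of_laplacian_eq_zero (radialExtension_smul U) b
    (isOpen_coneOver hΓ) (contDiffOn_radialExtension hΓ h.1) (R := θ + ε)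
    (fun t ht φ => by rw [← coe_spherePoint, coe_mem_coneOver]; exact hall t ht φ)
    (fun t ht φ => h.2 (spherePoint b t φ) (hall t ht φ)) hθ.1.le hθ.2 (by linarith)
  simpa only [← coe_spherePoint, radialExtension_coe, hb] using key

theorem HasAzimuthalMeanValue.beltramiHarmonicOn {Γ : Set UnitSphere} (hΓ : IsOpen Γ)
    {U : UnitSphere → ℝ} (hU : ContinuousOn U Γ) (h : HasAzimuthalMeanValue U Γ) :
    BeltramiHarmonicOn U Γ := by
  have hC2 : ContMDiffOn (𝓡 2) 𝓘(ℝ, ℝ) 2 U Γ := fun ξ hξ =>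
    (contMDiffAt_of_contDiffAt_radialExtension (h.contDiffAt hΓ hU hξ)).contMDiffWithinAt
  refine ⟨hC2, fun ξ hξ => ?_⟩
  obtain ⟨b, hb⟩ := exists_orthonormalBasis_zero_eq ξ
  obtain ⟨ε, hε, hεΓ⟩ := Metric.isOpen_iff.1 hΓ ξ hξ
  have hlim : Tendsto (fun t => 2 - 2 * cos t) (𝓝 0) (𝓝 0) := by
    have : Continuous fun t => 2 - 2 * cos t := by fun_prop
    simpa using this.tendsto 0
  -- A point of the closed cap of angle `t` has squared distance at most `2 - 2 * cos t` from the
  -- center, so small angles keep the cap in the `ε`-ball.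
  obtain ⟨R', hR', hR'b⟩ := Metric.eventually_nhds_iff_ball.1
    (hlim.eventually_lt_const (by positivity : 0 < ε ^ 2))
  obtain ⟨R, hR, hRR', hRπ⟩ : ∃ R : ℝ, 0 < R ∧ R ≤ R' ∧ R ≤ π :=
    ⟨min R' π, lt_min hR' pi_pos, min_le_left _ _, min_le_right _ _⟩
  have hcap : ∀ t ∈ Ioo (-R) R, ∀ η : UnitSphere, cos t ≤ ⟪(ξ : E3), (η : E3)⟫ → η ∈ Γ := by
    intro t ht η hη
    refine hεΓ ?_
    have h1 := hR'b t (by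
      rw [Metric.mem_ball, Real.dist_eq, sub_zero, abs_lt]
      constructor <;> linarith [ht.1, ht.2])
    rw [Metric.mem_ball, dist_comm]
    refine lt_of_pow_lt_pow_left₀ 2 hε.le ?_
    rw [dist_sq_unitSphere]
    linarith
  have key := laplacian_eq_zero_of_azimuthalMean_eq (radialExtension_smul U) b
    (C := 2 * π * U ξ) hR hRπ (isOpen_coneOver hΓ) (contDiffOn_radialExtension hΓ hC2)
    (fun t ht φ => by
      rw [← coe_spherePoint, coe_mem_coneOver]
      exact hcap t ht _ (by rw [← hb, coe_spherePoint, inner_axis_polarPoint]))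
    (fun t ht => by
      simp only [← coe_spherePoint, radialExtension_coe]
      exact h ξ hξ b hb t ⟨ht.1, ht.2.trans_le hRπ⟩ (hcap t ⟨by linarith [ht.1], ht.2⟩))
  rw [hb] at key
  exact key

end

theorem mainTheorem10 (Γ : Set UnitSphere) (hΓ : IsOpen Γ) (U : UnitSphere → ℝ)
    (hU : ContinuousOn U Γ) :
    BeltramiHarmonicOn U Γ ↔
      ∀ ξ ∈ Γ, ∀ ρ : ℝ, 0 < ρ → ρ < 2 → closure (sphericalCap ξ ρ) ⊆ Γ →
        U ξ = 1 / (2 * Real.pi * √(ρ * (2 - ρ))) *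
          arcLengthIntegral (frontier (sphericalCap ξ ρ)) U := by
  rw [meanValue_iff]
  exact ⟨fun h => h.hasAzimuthalMeanValue hΓ,
    fun h => HasAzimuthalMeanValue.beltramiHarmonicOn hΓ hU h⟩
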